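/- For a topological space $X$ let $C(X)$ be the space of continuous functions $X\to\mathbb{C}$ with the compact-open topology. A \emph{normed space of continuous functions} (NSCF) over $X$ is a linear subspace $\mathbf{F}\subset C(X)$ equipped with a norm for which the inclusion $\mathbf{F}\to C(X)$ is continuous. Let $B_{\mathbf{F}}$ and $\overline{B}_{\mathbf{F}}$ be its open and closed unit balls. $\mathbf{F}$ is \emph{$1$-independent} if for every $x\in X$ there is $f\in\mathbf{F}$ with $f(x)\neq 0$; it is \emph{(weakly) compactly embedded} if $B_{\mathbf{F}}$ is relatively compact in the (weak) topology of $C(X)$. A normed space is \emph{nearly strictly convex} if the convex subsets of its unit sphere are totally bounded. A \emph{unitary} is a surjective linear isometry. For $\Phi:Y\to X$ and $\omega:Y\to\mathbb{C}$ (not necessarily continuous) let $[W_{\Phi,\omega}f](y)=\omega(y)f(\Phi(y))$. Let $X$ and $Y$ be Hausdorff spaces, let $\mathbf{E}$ be an NSCF over $Y$, and let $\mathbf{F}$ be a $1$-independent NSCF over $X$ that satisfies one of the following conditions: (i) $\mathbf{F}$ is compactly embedded; (ii) $\mathbf{F}$ is weakly compactly embedded and nearly strictly convex, and $\overline{B}_{\mathbf{F}}$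 is closed in $C(X)$; (iii) $\mathbf{F}$ is weakly compactly embedded and $\mathbf{F}^{**}$ is nearly strictly convex; (iv) $\mathbf{F}$ is reflexive and nearly strictly convex. Let $\Phi:Y\to X$ be a map such that $\Phi(Y)$ is connected (the empty set counts as connected), and let $\omega,\upsilon:Y\to\mathbb{C}\setminus\{0\}$. If there is a unitary $S:\mathbf{F}\to\mathbf{F}$ such that $W_{\Phi,\omega}=W_{\Phi,\upsilon}S$ on $\mathbf{F}$, then $\upsilon=\lambda\omega$ for some $\lambda\in\mathbb{C}$ with $|\lambda|=1$. Moreover, if $W_{\Phi,\omega}$ and $W_{\Phi,\upsilon}$ are both unitaries from $\mathbf{F}$ onto $\mathbf{E}$, then such an $S$ exists, and hence $\upsilon=\lambda\omega$ for some $\lambda\in\mathbb{C}$ with $|\lambda|=1$. -/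

import Mathlib

noncomputable section

/-- A normed space of continuous functions (NSCF) over `X`: a linear subspace of `C(X, ℂ)` with a
norm whose topology is stronger than the compact-open one.  The normed space is `F`, and it is
identified with a subspace of `C(X, ℂ)` by the inclusion operator `incl`, an injective linear map
that is continuous for the compact-open topology (the topology that `C(X, ℂ)` carries). -/
structure NSCF (X : Type*) [TopologicalSpace X] (F : Type*) [NormedAddCommGroup F]
    [NormedSpace ℂ F] where
  incl : F →L[ℂ] C(X, ℂ)
  injective : Function.Injective incl

/-- A normed space is nearly strictly convex if every convex subset of its unit sphere is
totally bounded. -/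
def NearlyStrictlyConvex (E : Type*) [NormedAddCommGroup E] [NormedSpace ℂ E] : Prop :=
  ∀ C : Set E, C ⊆ Metric.sphere 0 1 → Convex ℝ C → TotallyBounded C

/-- A normed space is reflexive if the canonical embedding into its bidual is onto. -/
def IsReflexiveSpace (E : Type*) [NormedAddCommGroup E] [NormedSpace ℂ E] : Prop :=
  Function.Surjective (NormedSpace.inclusionInDoubleDual ℂ E)

/-- The weighted composition operator with composition symbol `Φ` and multiplicative symbol `ω`,
`f ↦ (y ↦ ω y * f (Φ y))`, between the spaces of all complex functions. -/
def wco {X Y : Type*} (Φ : Y → X) (ω : Y → ℂ) : (X → ℂ) →ₗ[ℂ] (Y → ℂ) where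
  toFun f := fun y => ω y * f (Φ y)
  map_add' f g := by
    funext y
    simp [mul_add]
  map_smul' c f := by
    funext y
    simp [mul_left_comm]

namespace NSCF

section

variable {X : Type*} [TopologicalSpace X] {F : Type*} [NormedAddCommGroup F] [NormedSpace ℂ F]

/-- For every `x` there is a function of the space that does not vanish at `x`. -/
def OneIndependent (J : NSCF X F) : Prop :=
  ∀ x : X, ∃ f : F, J.incl f x ≠ 0

/-- The unit ball is relatively compact in `C(X, ℂ)`. -/
def CompactlyEmbedded (J : NSCF X F) : Prop :=
  IsCompact (closure (J.incl '' Metric.ball 0 1))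

/-- The unit ball is relatively compact in the weak topology of the locally convex
space `C(X, ℂ)`. -/
def WeaklyCompactlyEmbedded (J : NSCF X F) : Prop :=
  IsCompact (closure (toWeakSpace ℂ C(X, ℂ) '' (J.incl '' Metric.ball 0 1)))

/-- The disjunction of the four sufficient conditions for rigidity. -/
def RigidityCondition (J : NSCF X F) : Prop :=
  J.CompactlyEmbedded ∨
  (J.WeaklyCompactlyEmbedded ∧ NearlyStrictlyConvex F ∧
    IsClosed (J.incl '' Metric.closedBall 0 1)) ∨
  (J.WeaklyCompactlyEmbedded ∧ NearlyStrictlyConvex (StrongDual ℂ (StrongDual ℂ F))) ∨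
  (IsReflexiveSpace F ∧ NearlyStrictlyConvex F)

/-- The weighted composition operator with symbols `Φ`, `ω` is a unitary from one NSCF onto
another: it maps the first into the second, and as such it is a surjective linear isometry. -/
def IsUnitaryWCO {Y : Type*} [TopologicalSpace Y] {E : Type*} [NormedAddCommGroup E]
    [NormedSpace ℂ E] (J : NSCF X F) (K : NSCF Y E) (Φ : Y → X) (ω : Y → ℂ) : Prop :=
  ∃ U : F ≃ₗᵢ[ℂ] E, ∀ f : F, (K.incl (U f) : Y → ℂ) = wco Φ ω (J.incl f)

end

end NSCF

end

/-!
The relation `W_{Φ,ω} = W_{Φ,υ} S` says that `S` acts on restrictions to `Φ(Y)` as multiplication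
by a function `a`, with `a (Φ y) = ω y / υ y`: evaluation at a point `z` of `Φ(Y)` is an
eigenvector of the adjoint of the isometry `S`, so that `‖a z‖ = 1`
(`NSCF.norm_eq_one_of_eigen`). The function `a` is shown to be locally constant on `Φ(Y)`, hence
constant by connectedness.

To this end, fix `z₀` in `Φ(Y)`, put `β = a z₀`, and take `f` with `f z₀ ≠ 0` and `‖f‖ < 1`. The
Cesàro means of `β⁻ᵏ Sᵏ f` stay in the unit ball of `F`, and at a point `z` of `Φ(Y)` they converge
to `f z` if `a z = β` and to `0` otherwise. Under every form of the rigidity condition,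
sequences in the unit ball have pointwise limits in `C(X, ℂ)` along ultrafilters
(`NSCF.RigidityCondition.pointwise`), so the pointwise limit on `Φ(Y)` is the restriction of a
continuous function `h` on `X`. Since `h z₀ = f z₀ ≠ 0`, `h` does not vanish near `z₀`, and
therefore `a = β` near `z₀` in `Φ(Y)`.

The compact and weakly compact embeddings give this directly, because point evaluations are
continuous linear functionals on `C(X, ℂ)`; for a reflexive space it follows from the
Banach–Alaoglu theorem.
-/

open Filter Topology

/-- The Cesàro means of the powers of a unimodular number other than `1` tend to `0`. -/
theorem tendsto_cesaro_pow_zero {w : ℂ} (hw : ‖w‖ = 1) (hw1 : w ≠ 1) :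
    Tendsto (fun n : ℕ => (n : ℂ)⁻¹ * ∑ k ∈ Finset.range n, w ^ k) atTop (𝓝 0) := by
  have hn : Tendsto (fun n : ℕ => (n : ℝ)⁻¹ * (2 / ‖w - 1‖)) atTop (𝓝 0) := by
    simpa using (tendsto_inv_atTop_nhds_zero_nat (𝕜 := ℝ)).mul_const (2 / ‖w - 1‖)
  refine squeeze_zero_norm (fun n => ?_) hn
  rw [norm_mul, norm_inv, Complex.norm_natCast, geom_sum_eq hw1, norm_div]
  gcongr
  calc ‖w ^ n - 1‖ ≤ ‖w ^ n‖ + ‖(1 : ℂ)‖ := norm_sub_le _ _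
    _ = 2 := by rw [norm_pow, hw]; norm_num

namespace NSCF

variable {X : Type*} [TopologicalSpace X] {F : Type*} [NormedAddCommGroup F] [NormedSpace ℂ F]

/-- Evaluation at a point, as a bounded linear functional on the space. -/
noncomputable def eval (J : NSCF X F) (x : X) : StrongDual ℂ F :=
  (ContinuousMap.evalCLM ℂ x).comp J.incl

theorem eval_apply (J : NSCF X F) (x : X) (f : F) : J.eval x f = J.incl f x := rfl

/-- The form of relative compactness of the unit ball in `C(X, ℂ)` for pointwise convergence that
concerns sequences: along every ultrafilter on `ℕ`, a sequence in the unit ball converges pointwise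
to a continuous function. -/
def PointwiseCompactlyEmbedded (J : NSCF X F) : Prop :=
  ∀ (U : Ultrafilter ℕ) (g : ℕ → F), (∀ n, ‖g n‖ < 1) →
    ∃ h : C(X, ℂ), ∀ x, Tendsto (fun n => J.incl (g n) x) U (𝓝 (h x))

theorem CompactlyEmbedded.pointwise {J : NSCF X F} (hJ : J.CompactlyEmbedded) :
    J.PointwiseCompactlyEmbedded := by
  intro U g hg
  obtain ⟨h, -, hh⟩ := hJ.ultrafilter_le_nhds' (U.map fun n => J.incl (g n))
    (Eventually.of_forall (f := (U : Filter ℕ)) fun n =>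
      subset_closure ⟨g n, by simpa using hg n, rfl⟩)
  exact ⟨h, fun x => ((ContinuousMap.evalCLM ℂ x : C(X, ℂ) →L[ℂ] ℂ).continuous.tendsto h).comp hh⟩

theorem WeaklyCompactlyEmbedded.pointwise {J : NSCF X F} (hJ : J.WeaklyCompactlyEmbedded) :
    J.PointwiseCompactlyEmbedded := by
  intro U g hg
  obtain ⟨h, -, hh⟩ := hJ.ultrafilter_le_nhds' (U.map fun n => toWeakSpace ℂ _ (J.incl (g n)))
    (Eventually.of_forall (f := (U : Filter ℕ)) fun n =>
      subset_closure ⟨_, ⟨g n, by simpa using hg n, rfl⟩, rfl⟩)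
  refine ⟨(toWeakSpace ℂ _).symm h, fun x => ?_⟩
  have hc : Continuous fun v : WeakSpace ℂ C(X, ℂ) => (toWeakSpace ℂ _).symm v x :=
    WeakBilin.eval_continuous _ (ContinuousMap.evalCLM ℂ x : C(X, ℂ) →L[ℂ] ℂ)
  exact (hc.tendsto h).comp hh

/-- By the Banach–Alaoglu theorem a bounded sequence has, along an ultrafilter, a weak-star limit
in the bidual, which reflexivity places in the space itself. -/
theorem pointwise_of_isReflexiveSpace (J : NSCF X F) (hF : IsReflexiveSpace F) :
    J.PointwiseCompactlyEmbedded := by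
  intro U g hg
  have hK := WeakDual.isCompact_closedBall (𝕜 := ℂ) (0 : StrongDual ℂ (StrongDual ℂ F)) 1
  obtain ⟨ξ, -, hξ⟩ := hK.ultrafilter_le_nhds'
    (U.map fun n => StrongDual.toWeakDual (NormedSpace.inclusionInDoubleDual ℂ F (g n)))
    (Eventually.of_forall (f := (U : Filter ℕ)) fun n => by
      have := (NormedSpace.double_dual_bound ℂ F (g n)).trans (hg n).le
      simpa using this)
  obtain ⟨h, hh⟩ := hF (WeakDual.toStrongDual ξ)
  refine ⟨J.incl h, fun x => ?_⟩
  have hx : ξ (J.eval x) = J.incl h x := by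
    rw [← WeakDual.toStrongDual_apply, ← hh, NormedSpace.dual_def, eval_apply]
  rw [← hx]
  exact ((WeakDual.eval_continuous (J.eval x)).tendsto ξ).comp hξ

theorem RigidityCondition.pointwise {J : NSCF X F} (hJ : J.RigidityCondition) :
    J.PointwiseCompactlyEmbedded := by
  rcases hJ with h | ⟨h, -⟩ | ⟨h, -⟩ | ⟨h, -⟩
  · exact h.pointwise
  · exact h.pointwise
  · exact h.pointwise
  · exact J.pointwise_of_isReflexiveSpace h

theorem OneIndependent.exists_norm_lt_one {J : NSCF X F} (hJ : J.OneIndependent) (x : X) :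
    ∃ f : F, ‖f‖ < 1 ∧ J.incl f x ≠ 0 := by
  obtain ⟨f, hf⟩ := hJ x
  have hpos : 0 < ‖f‖ + 1 := by positivity
  refine ⟨((‖f‖ + 1 : ℝ) : ℂ)⁻¹ • f, ?_, ?_⟩
  · rw [norm_smul, norm_inv, Complex.norm_of_nonneg hpos.le, inv_mul_lt_one₀ hpos]
    exact lt_add_one _
  · rw [map_smul, ContinuousMap.smul_apply, smul_eq_mul]
    exact mul_ne_zero (inv_ne_zero (Complex.ofReal_ne_zero.2 hpos.ne')) hf

/-- An eigenvalue of the adjoint of a unitary, with an evaluation as eigenvector, is unimodular. -/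
theorem norm_eq_one_of_eigen {J : NSCF X F} (hJ : J.OneIndependent) (S : F ≃ₗᵢ[ℂ] F) {x : X}
    {c : ℂ} (hc : ∀ f, J.incl (S f) x = c * J.incl f x) : ‖c‖ = 1 := by
  have hne : J.eval x ≠ 0 := fun h0 => by
    obtain ⟨f, hf⟩ := hJ x
    exact hf (by rw [← eval_apply, h0, zero_apply])
  have h : (J.eval x).comp (S.toContinuousLinearEquiv : F →L[ℂ] F) = c • J.eval x := by
    ext f
    exact hc f
  have hnorm := congrArg norm h
  rw [norm_smul, ContinuousLinearMap.opNorm_comp_linearIsometryEquiv] at hnorm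
  exact (mul_eq_right₀ (norm_ne_zero_iff.2 hne)).1 hnorm.symm

theorem incl_iterate_of_eigen (J : NSCF X F) (S : F ≃ₗᵢ[ℂ] F) {x : X} {c : ℂ}
    (hc : ∀ f, J.incl (S f) x = c * J.incl f x) (f : F) (k : ℕ) :
    J.incl (S^[k] f) x = c ^ k * J.incl f x := by
  induction k with
  | zero => simp
  | succ k ih => rw [Function.iterate_succ_apply', hc, ih, pow_succ']; ring

/-- If a unitary acts on the restrictions to `Z` as multiplication by `a`, then `a` is locally
constant on `Z`. -/
theorem isLocallyConstant_of_eigen {J : NSCF X F} (hJ : J.OneIndependent)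
    (hP : J.PointwiseCompactlyEmbedded) (S : F ≃ₗᵢ[ℂ] F) {Z : Set X} (a : Z → ℂ)
    (ha : ∀ (z : Z) (f : F), J.incl (S f) z = a z * J.incl f z) : IsLocallyConstant a := by
  rw [IsLocallyConstant.iff_eventually_eq]
  intro z₀
  have hnorm : ∀ z, ‖a z‖ = 1 := fun z => norm_eq_one_of_eigen hJ S (ha z)
  have hβ : a z₀ ≠ 0 := norm_ne_zero_iff.1 (by rw [hnorm]; exact one_ne_zero)
  obtain ⟨f, hf1, hf⟩ := hJ.exists_norm_lt_one z₀
  -- The means of `β⁻ᵏ Sᵏ f`, which project onto the part of `f` that lives on `{a = β}`, `β = a z₀`.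
  let g : ℕ → F := fun n => (n : ℂ)⁻¹ • ∑ k ∈ Finset.range n, (a z₀)⁻¹ ^ k • S^[k] f
  have hS : ∀ k, ‖S^[k] f‖ = ‖f‖ := fun k => by
    induction k with
    | zero => rfl
    | succ k ih => rw [Function.iterate_succ_apply', S.norm_map, ih]
  have hg : ∀ n, ‖g n‖ < 1 := fun n => by
    refine lt_of_le_of_lt ?_ hf1
    have hsum : ‖∑ k ∈ Finset.range n, (a z₀)⁻¹ ^ k • S^[k] f‖ ≤ n * ‖f‖ := by
      refine (norm_sum_le_of_le (Finset.range n) (f := fun k => (a z₀)⁻¹ ^ k • S^[k] f)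
        (n := fun _ => ‖f‖) fun k _ => ?_).trans_eq (by simp)
      rw [norm_smul, norm_pow, norm_inv, hnorm, hS]
      simp
    rw [norm_smul, norm_inv, Complex.norm_natCast]
    rcases n.eq_zero_or_pos with rfl | hn
    · simp
    · exact (inv_mul_le_iff₀ (Nat.cast_pos.2 hn)).2 hsum
  have hgz : ∀ (z : Z) n, J.incl (g n) z =
      ((n : ℂ)⁻¹ * ∑ k ∈ Finset.range n, (a z / a z₀) ^ k) * J.incl f z := fun z n => by
    rw [← eval_apply, map_smul, map_sum, smul_eq_mul, mul_assoc, Finset.sum_mul]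
    congr 1
    refine Finset.sum_congr rfl fun k _ => ?_
    rw [map_smul, eval_apply, J.incl_iterate_of_eigen S (ha z), smul_eq_mul, div_pow, inv_pow]
    ring
  obtain ⟨h, hh⟩ := hP (hyperfilter ℕ) g hg
  have hle : (hyperfilter ℕ : Filter ℕ) ≤ atTop := Nat.hyperfilter_le_atTop
  have h₀ : h z₀ ≠ 0 := by
    have hlim : Tendsto (fun n => J.incl (g n) z₀) (hyperfilter ℕ) (𝓝 (J.incl f z₀)) := by
      refine (tendsto_const_nhds.congr' ?_).mono_left hle
      filter_upwards [eventually_ne_atTop 0] with n hn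
      rw [hgz, div_self hβ]
      simp [hn]
    rw [tendsto_nhds_unique (hh z₀) hlim]
    exact hf
  have hev : ∀ᶠ z : Z in 𝓝 z₀, h z ≠ 0 :=
    (h.continuous.comp continuous_subtype_val).continuousAt.eventually_ne h₀
  filter_upwards [hev] with z hz
  by_contra hne
  have hlim : Tendsto (fun n => J.incl (g n) z) (hyperfilter ℕ) (𝓝 0) := by
    have := (tendsto_cesaro_pow_zero (w := a z / a z₀) (by rw [norm_div, hnorm, hnorm, div_one])
      (by rwa [Ne, div_eq_one_iff_eq hβ])).mul_const (J.incl f z)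
    rw [zero_mul] at this
    exact (this.mono_left hle).congr fun n => (hgz z n).symm
  exact hz (tendsto_nhds_unique (hh z) hlim)

/-- Rigidity of the multiplicative symbol up to a unimodular constant. -/
theorem exists_unimodular_of_wco_eq {Y : Type*} {J : NSCF X F} (hJ : J.OneIndependent)
    (hP : J.PointwiseCompactlyEmbedded) {Φ : Y → X} (hΦ : IsPreconnected (Set.range Φ))
    {ω υ : Y → ℂ} (hυ : ∀ y, υ y ≠ 0) (S : F ≃ₗᵢ[ℂ] F)
    (hS : ∀ f : F, wco Φ ω (J.incl f) = wco Φ υ (J.incl (S f))) :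
    ∃ c : ℂ, ‖c‖ = 1 ∧ ∀ y, υ y = c * ω y := by
  have hmul : ∀ y f, J.incl (S f) (Φ y) = ω y / υ y * J.incl f (Φ y) := fun y f => by
    have h : ω y * J.incl f (Φ y) = υ y * J.incl (S f) (Φ y) := congrFun (hS f) y
    rw [div_mul_eq_mul_div, h, mul_div_cancel_left₀ _ (hυ y)]
  have hex : ∀ z : Set.range Φ, ∃ c : ℂ, ∀ f, J.incl (S f) z = c * J.incl f z := by
    rintro ⟨_, y, rfl⟩
    exact ⟨_, hmul y⟩
  choose a ha using hex
  have hloc := isLocallyConstant_of_eigen hJ hP S a ha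
  have : PreconnectedSpace (Set.range Φ) := isPreconnected_iff_preconnectedSpace.1 hΦ
  rcases isEmpty_or_nonempty Y with hY | ⟨⟨y₀⟩⟩
  · exact ⟨1, norm_one, fun y => hY.elim y⟩
  have hnorm := norm_eq_one_of_eigen hJ S (ha ⟨Φ y₀, y₀, rfl⟩)
  have hne : a ⟨Φ y₀, y₀, rfl⟩ ≠ 0 := norm_ne_zero_iff.1 (by rw [hnorm]; exact one_ne_zero)
  refine ⟨(a ⟨Φ y₀, y₀, rfl⟩)⁻¹, by rw [norm_inv, hnorm, inv_one], fun y => ?_⟩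
  obtain ⟨f, hf⟩ := hJ (Φ y)
  have hay : a ⟨Φ y, y, rfl⟩ = ω y / υ y :=
    mul_right_cancel₀ hf ((ha ⟨Φ y, y, rfl⟩ f).symm.trans (hmul y f))
  rw [eq_inv_mul_iff_mul_eq₀ hne, hloc.apply_eq_of_preconnectedSpace _ ⟨Φ y, y, rfl⟩, hay,
    div_mul_cancel₀ _ (hυ y)]

/-- Two unitary weighted composition operators with the same composition symbol differ by a
unitary of the domain. -/
theorem IsUnitaryWCO.exists_unitary {Y : Type*} [TopologicalSpace Y] {E : Type*}
    [NormedAddCommGroup E] [NormedSpace ℂ E] {J : NSCF X F} {K : NSCF Y E} {Φ : Y → X}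
    {ω υ : Y → ℂ} (hω : J.IsUnitaryWCO K Φ ω) (hυ : J.IsUnitaryWCO K Φ υ) :
    ∃ S : F ≃ₗᵢ[ℂ] F, ∀ f : F, wco Φ ω (J.incl f) = wco Φ υ (J.incl (S f)) := by
  obtain ⟨U, hU⟩ := hω
  obtain ⟨V, hV⟩ := hυ
  refine ⟨U.trans V.symm, fun f => ?_⟩
  rw [← hU, ← hV, LinearIsometryEquiv.trans_apply, LinearIsometryEquiv.apply_symm_apply]

end NSCF

theorem mainTheorem2 {X Y F E : Type*}
    [TopologicalSpace X] [T2Space X] [TopologicalSpace Y] [T2Space Y]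
    [NormedAddCommGroup F] [NormedSpace ℂ F] [NormedAddCommGroup E] [NormedSpace ℂ E]
    (J : NSCF X F) (K : NSCF Y E)
    (hJ : J.OneIndependent) (hcond : J.RigidityCondition)
    (Φ : Y → X) (hΦ : IsPreconnected (Set.range Φ))
    (ω υ : Y → ℂ) (hω : ∀ y, ω y ≠ 0) (hυ : ∀ y, υ y ≠ 0) :
    ((∃ S : F ≃ₗᵢ[ℂ] F, ∀ f : F, wco Φ ω (J.incl f) = wco Φ υ (J.incl (S f))) →
      ∃ c : ℂ, ‖c‖ = 1 ∧ ∀ y, υ y = c * ω y) ∧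
    (J.IsUnitaryWCO K Φ ω → J.IsUnitaryWCO K Φ υ →
      (∃ S : F ≃ₗᵢ[ℂ] F, ∀ f : F, wco Φ ω (J.incl f) = wco Φ υ (J.incl (S f))) ∧
      ∃ c : ℂ, ‖c‖ = 1 ∧ ∀ y, υ y = c * ω y) := by
  have hrigid : (∃ S : F ≃ₗᵢ[ℂ] F, ∀ f : F, wco Φ ω (J.incl f) = wco Φ υ (J.incl (S f))) →
      ∃ c : ℂ, ‖c‖ = 1 ∧ ∀ y, υ y = c * ω y := fun ⟨S, hS⟩ =>
    NSCF.exists_unimodular_of_wco_eq hJ hcond.pointwise hΦ hυ S hS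
  exact ⟨hrigid, fun h₁ h₂ => ⟨h₁.exists_unitary h₂, hrigid (h₁.exists_unitary h₂)⟩⟩
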